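/- All graphs are finite, simple and undirected. For a connected graph $G$ with vertex set $V(G)$, let $d_G(u,v)$ be the distance between $u$ and $v$, let $D(G)=(d_G(u,v))_{u,v\in V(G)}$ be the distance matrix, and let $T(G)$ be the diagonal matrix whose $u$-th diagonal entry is $\sum_{v\in V(G)}d_G(u,v)$. For $\alpha\in[0,1)$ let $D_\alpha(G)=\alpha T(G)+(1-\alpha)D(G)$, and let $\mu_\alpha(G)$ denote the largest eigenvalue of the real symmetric matrix $D_\alpha(G)$. For integers $2\le\Delta\le n-1$, let $B_{n,\Delta}$ be the tree of order $n$ obtained by attaching $\Delta-1$ pendant vertices to one terminal vertex of the path on $n-\Delta+1$ vertices. Theorem. Let $\alpha\in[0,1)$, and let $G$ be a connected graph of order $n\ge 5$ with maximum degree $\Delta$, where $2\le\Delta\le n-1$. Then \[ \mu_\alpha(G)\le\mu_\alpha(B_{n,\Delta}), \] with equality if and only if $G\cong B_{n,\Delta}$. -/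

import Mathlib

/-- The transmission of a vertex `u`: the sum of the distances from `u` to all vertices of `G`. -/
noncomputable def SimpleGraph.transmission {V : Type*} [Fintype V] (G : SimpleGraph V) (u : V) : ℕ :=
  ∑ v, G.dist u v

/-- The distance matrix of `G`, with real entries. -/
noncomputable def SimpleGraph.distanceMatrix {V : Type*} (G : SimpleGraph V) : Matrix V V ℝ :=
  Matrix.of fun u v => (G.dist u v : ℝ)

/-- The transmission matrix of `G`: the diagonal matrix of vertex transmissions. -/
noncomputable def SimpleGraph.transmissionMatrix {V : Type*} [Fintype V] [DecidableEq V]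
    (G : SimpleGraph V) : Matrix V V ℝ :=
  Matrix.diagonal fun u => (G.transmission u : ℝ)

/-- The matrix `D_α(G) = α T(G) + (1 - α) D(G)`. -/
noncomputable def SimpleGraph.distanceAlphaMatrix {V : Type*} [Fintype V] [DecidableEq V]
    (G : SimpleGraph V) (α : ℝ) : Matrix V V ℝ :=
  α • G.transmissionMatrix + (1 - α) • G.distanceMatrix

/-- The distance `α`-spectral radius of `G`: the largest (real) eigenvalue of the symmetric matrix
`D_α(G)`. -/
noncomputable def SimpleGraph.distanceAlphaSpectralRadius {V : Type*} [Fintype V] [DecidableEq V]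
    (G : SimpleGraph V) (α : ℝ) : ℝ :=
  sSup {μ : ℝ | Module.End.HasEigenvalue (Matrix.toLin' (G.distanceAlphaMatrix α)) μ}

theorem SimpleGraph.distanceAlphaMatrix_isHermitian {V : Type*} [Fintype V] [DecidableEq V]
    (G : SimpleGraph V) (α : ℝ) : (G.distanceAlphaMatrix α).IsHermitian := by
  ext u v
  by_cases h : u = v
  · subst h; simp
  · simp [distanceAlphaMatrix, transmissionMatrix, distanceMatrix, h, Ne.symm h,
      SimpleGraph.dist_comm]

/-- The supremum in the definition is a maximum, so no junk value occurs. -/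
theorem SimpleGraph.isGreatest_distanceAlphaSpectralRadius {V : Type*} [Fintype V] [DecidableEq V]
    [Nonempty V] (G : SimpleGraph V) (α : ℝ) :
    IsGreatest {μ : ℝ | Module.End.HasEigenvalue (Matrix.toLin' (G.distanceAlphaMatrix α)) μ}
      (G.distanceAlphaSpectralRadius α) := by
  have h : {μ : ℝ | Module.End.HasEigenvalue (Matrix.toLin' (G.distanceAlphaMatrix α)) μ}
      = Set.range (G.distanceAlphaMatrix_isHermitian α).eigenvalues := by
    rw [← (G.distanceAlphaMatrix_isHermitian α).spectrum_real_eq_range_eigenvalues]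
    ext μ
    rw [Set.mem_ofPred_eq, Module.End.hasEigenvalue_iff_mem_spectrum, Matrix.spectrum_toLin']
  unfold distanceAlphaSpectralRadius
  rw [h]
  exact ⟨(Set.range_nonempty _).csSup_mem (Set.finite_range _),
    fun x hx => le_csSup (Set.finite_range _).bddAbove hx⟩

/-- The tree `B_{n,Δ}` (for `2 ≤ Δ ≤ n - 1`) on the vertices `0, …, n - 1`: the vertices
`0, 1, …, n - Δ` form, in this order, a path with `n - Δ + 1` vertices, and each of the remaining
`Δ - 1` vertices `n - Δ + 1, …, n - 1` is joined exactly to the terminal vertex `n - Δ` of that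
path. -/
def broomGraph (n Δ : ℕ) : SimpleGraph (Fin n) :=
  SimpleGraph.fromRel fun i j =>
    (i.val + 1 = j.val ∧ j.val ≤ n - Δ) ∨ (i.val = n - Δ ∧ n - Δ < j.val)

/-! There are finitely many graphs on `V`, so some connected graph of maximum degree `Δ` maximizes
the radius. The radius is invariant under isomorphism, hence the inequality and its equality case
both follow once every maximizer is shown to be a broom. Graphs are compared through a positive
eigenvector `y` of `D_α(G)`. The form `yᵀ D_α(H) y` is a sum of distances in `H` with positive
weights not depending on `H`, so a larger weighted distance sum forces a larger radius
(`exists_weight`). Deleting edges while staying connected therefore raises the radius, and a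
maximizer is a tree. For a tree, a part `A` hanging at `v` is moved to `p` or to `q`, two vertices
in different branches at `v`. A suitable positive combination of the two changes is positive, so one
of the moves raises the radius (`distanceAlphaSpectralRadius_lt_slide`). If both moves preserve the
maximum degree, the graph was no maximizer. This rules out a vertex of degree at least 3 other than
a chosen `u` of degree `Δ`, and, when `Δ ≥ 3`, a second non-leaf neighbour of `u`. What remains is a
broom. -/

/-! ### Rayleigh quotients and positive eigenvectors -/

open Matrix in
theorem Matrix.IsHermitian.posSemidef_smul_one_sub {V : Type*} [Fintype V] [DecidableEq V]
    {M : Matrix V V ℝ} (hM : M.IsHermitian) {c : ℝ}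
    (hc : ∀ μ, Module.End.HasEigenvalue (Matrix.toLin' M) μ → μ ≤ c) :
    (c • (1 : Matrix V V ℝ) - M).PosSemidef := by
  have hN : (c • (1 : Matrix V V ℝ) - M).IsHermitian := by
    refine Matrix.IsHermitian.sub ?_ hM
    ext i j
    by_cases h : i = j <;> simp [h, eq_comm]
  rw [hN.posSemidef_iff_eigenvalues_nonneg]
  intro i
  have h1 := hN.mulVec_eigenvectorBasis i
  set e : V → ℝ := WithLp.ofLp (hN.eigenvectorBasis i) with he
  have hne : e ≠ 0 := by
    intro h0
    apply hN.eigenvectorBasis.orthonormal.ne_zero i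
    ext j
    exact congrFun h0 j
  have h2 : M *ᵥ e = (c - hN.eigenvalues i) • e := by
    rw [Matrix.sub_mulVec, Matrix.smul_mulVec, Matrix.one_mulVec] at h1
    rw [sub_smul, ← h1]
    abel
  have h3 : Module.End.HasEigenvalue (Matrix.toLin' M) (c - hN.eigenvalues i) :=
    Module.End.hasEigenvalue_of_hasEigenvector (x := e)
      ⟨Module.End.mem_eigenspace_iff.2 (by rw [Matrix.toLin'_apply, h2]), hne⟩
  have := hc _ h3
  simp only [Pi.zero_apply]
  linarith

namespace SimpleGraph

open Matrix

variable {V : Type*} [Fintype V] [DecidableEq V]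

theorem distanceAlphaMatrix_mulVec (G : SimpleGraph V) (α : ℝ) (x : V → ℝ) (u : V) :
    (G.distanceAlphaMatrix α *ᵥ x) u
      = ∑ v, (G.dist u v : ℝ) * (α * x u + (1 - α) * x v) := by
  have h : (G.distanceAlphaMatrix α *ᵥ x) u
      = α * (G.transmission u * x u) + (1 - α) * ∑ v, (G.dist u v : ℝ) * x v := by
    rw [distanceAlphaMatrix, Matrix.add_mulVec, Matrix.smul_mulVec, Matrix.smul_mulVec,
      Pi.add_apply, Pi.smul_apply, Pi.smul_apply, transmissionMatrix, mulVec_diagonal]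
    rfl
  rw [h, transmission, Nat.cast_sum, Finset.sum_mul, Finset.mul_sum, Finset.mul_sum,
    ← Finset.sum_add_distrib]
  exact Finset.sum_congr rfl fun v _ => by ring

/-- The graph enters only through the distances; averaging the two ways of writing the diagonal part
makes the remaining factor symmetric in `u` and `v`. -/
theorem dotProduct_distanceAlphaMatrix_mulVec (G : SimpleGraph V) (α : ℝ) (x : V → ℝ) :
    x ⬝ᵥ (G.distanceAlphaMatrix α *ᵥ x)
      = ∑ u, ∑ v, (G.dist u v : ℝ) * (α / 2 * (x u ^ 2 + x v ^ 2) + (1 - α) * (x u * x v)) := by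
  have h1 : x ⬝ᵥ (G.distanceAlphaMatrix α *ᵥ x)
      = ∑ u, ∑ v, (G.dist u v : ℝ) * (α * x u ^ 2 + (1 - α) * (x u * x v)) := by
    simp only [dotProduct, distanceAlphaMatrix_mulVec, Finset.mul_sum]
    exact Finset.sum_congr rfl fun u _ => Finset.sum_congr rfl fun v _ => by ring
  have h2 : x ⬝ᵥ (G.distanceAlphaMatrix α *ᵥ x)
      = ∑ u, ∑ v, (G.dist u v : ℝ) * (α * x v ^ 2 + (1 - α) * (x u * x v)) := by
    rw [h1, Finset.sum_comm]
    exact Finset.sum_congr rfl fun u _ => Finset.sum_congr rfl fun v _ => by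
      rw [dist_comm]; ring
  have h3 : x ⬝ᵥ (G.distanceAlphaMatrix α *ᵥ x)
      = (x ⬝ᵥ (G.distanceAlphaMatrix α *ᵥ x) + x ⬝ᵥ (G.distanceAlphaMatrix α *ᵥ x)) / 2 := by
    ring
  rw [h3]
  nth_rw 1 [h1]
  rw [h2, ← Finset.sum_add_distrib, Finset.sum_div]
  refine Finset.sum_congr rfl fun u _ => ?_
  rw [← Finset.sum_add_distrib, Finset.sum_div]
  exact Finset.sum_congr rfl fun v _ => by ring

theorem posSemidef_distanceAlphaSpectralRadius [Nonempty V] (G : SimpleGraph V) (α : ℝ) :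
    (G.distanceAlphaSpectralRadius α • (1 : Matrix V V ℝ) - G.distanceAlphaMatrix α).PosSemidef :=
  (G.distanceAlphaMatrix_isHermitian α).posSemidef_smul_one_sub
    fun _ h => (G.isGreatest_distanceAlphaSpectralRadius α).2 h

theorem dotProduct_distanceAlphaMatrix_mulVec_le [Nonempty V] (G : SimpleGraph V) (α : ℝ)
    (x : V → ℝ) :
    x ⬝ᵥ (G.distanceAlphaMatrix α *ᵥ x) ≤ G.distanceAlphaSpectralRadius α * (x ⬝ᵥ x) := by
  have h := (G.posSemidef_distanceAlphaSpectralRadius α).dotProduct_mulVec_nonneg x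
  simp only [star_trivial, Matrix.sub_mulVec, Matrix.smul_mulVec, Matrix.one_mulVec,
    dotProduct_sub, dotProduct_smul, smul_eq_mul] at h
  linarith

/-- Perron–Frobenius by hand: replacing an eigenvector by its absolute value does not decrease the
form, so `|x|` is again extremal. A zero entry would make a sum of nonnegative terms vanish, and
off-diagonal distances are positive, so `x` would be zero. -/
theorem exists_pos_eigenvector [Nontrivial V] {G : SimpleGraph V} (hG : G.Connected) {α : ℝ}
    (hα₁ : α < 1) :
    ∃ y : V → ℝ, (∀ u, 0 < y u) ∧
      G.distanceAlphaMatrix α *ᵥ y = G.distanceAlphaSpectralRadius α • y := by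
  obtain ⟨x, hx⟩ := (G.isGreatest_distanceAlphaSpectralRadius α).1.exists_hasEigenvector
  have hx1 : G.distanceAlphaMatrix α *ᵥ x = G.distanceAlphaSpectralRadius α • x := by
    have := hx.apply_eq_smul
    rwa [Matrix.toLin'_apply] at this
  set μ := G.distanceAlphaSpectralRadius α
  let y : V → ℝ := fun u => |x u|
  have hyy : y ⬝ᵥ y = x ⬝ᵥ x := by simp [y, dotProduct]
  have hle : μ * (y ⬝ᵥ y) ≤ y ⬝ᵥ (G.distanceAlphaMatrix α *ᵥ y) := by
    have : x ⬝ᵥ (G.distanceAlphaMatrix α *ᵥ x) = μ * (x ⬝ᵥ x) := by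
      rw [hx1, dotProduct_smul, smul_eq_mul]
    rw [hyy, ← this, dotProduct_distanceAlphaMatrix_mulVec, dotProduct_distanceAlphaMatrix_mulVec]
    refine Finset.sum_le_sum fun u _ => Finset.sum_le_sum fun v _ =>
      mul_le_mul_of_nonneg_left ?_ (Nat.cast_nonneg _)
    simp only [y, sq_abs]
    have h1 : x u * x v ≤ |x u| * |x v| := by
      rw [← abs_mul]; exact le_abs_self _
    have := mul_le_mul_of_nonneg_left h1 (sub_nonneg.2 hα₁.le)
    linarith
  have hPS := G.posSemidef_distanceAlphaSpectralRadius α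
  have h0 : y ⬝ᵥ ((μ • (1 : Matrix V V ℝ) - G.distanceAlphaMatrix α) *ᵥ y) = 0 := by
    have h := hPS.dotProduct_mulVec_nonneg y
    rw [star_trivial] at h
    refine le_antisymm ?_ h
    simp only [Matrix.sub_mulVec, Matrix.smul_mulVec, Matrix.one_mulVec,
      dotProduct_sub, dotProduct_smul, smul_eq_mul]
    linarith
  have hy1 : G.distanceAlphaMatrix α *ᵥ y = μ • y := by
    -- A zero of a positive semidefinite form lies in the kernel of its matrix.
    have := (hPS.dotProduct_mulVec_zero_iff y).1 (by rw [star_trivial]; exact h0)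
    rw [Matrix.sub_mulVec, Matrix.smul_mulVec, Matrix.one_mulVec, sub_eq_zero] at this
    exact this.symm
  refine ⟨y, fun u => ?_, hy1⟩
  by_contra hu
  have hu0 : y u = 0 := le_antisymm (not_lt.1 hu) (abs_nonneg _)
  apply hx.2
  have h2 := congrFun hy1 u
  rw [distanceAlphaMatrix_mulVec, Pi.smul_apply, hu0, smul_zero] at h2
  have hnn : ∀ v ∈ Finset.univ, 0 ≤ (G.dist u v : ℝ) * (α * 0 + (1 - α) * y v) := fun v _ =>
    mul_nonneg (Nat.cast_nonneg _) (by
      have := mul_nonneg (sub_nonneg.2 hα₁.le) (abs_nonneg (x v)); simpa [y] using this)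
  rw [Finset.sum_eq_zero_iff_of_nonneg hnn] at h2
  funext v
  by_cases huv : u = v
  · subst huv; simpa [y] using hu0
  · have h3 := h2 v (Finset.mem_univ v)
    have h4 : (G.dist u v : ℝ) ≠ 0 := by
      exact_mod_cast (hG.pos_dist_of_ne huv).ne'
    have h5 : 1 - α ≠ 0 := by linarith
    simpa [h4, h5, y] using h3

/-- A positive eigenvector of `D_α(G)` weighs the pairs of vertices in such a way that any graph
with a larger weighted sum of distances has a larger distance `α`-spectral radius. -/
theorem exists_weight [Nontrivial V] {G : SimpleGraph V} (hG : G.Connected) {α : ℝ}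
    (hα₀ : 0 ≤ α) (hα₁ : α < 1) :
    ∃ W : V → V → ℝ, (∀ u v, 0 < W u v) ∧ (∀ u v, W u v = W v u) ∧ ∀ H : SimpleGraph V,
      ∑ u, ∑ v, (G.dist u v : ℝ) * W u v < ∑ u, ∑ v, (H.dist u v : ℝ) * W u v →
        G.distanceAlphaSpectralRadius α < H.distanceAlphaSpectralRadius α := by
  obtain ⟨y, hy, hy1⟩ := exists_pos_eigenvector hG hα₁
  refine ⟨fun u v => α / 2 * (y u ^ 2 + y v ^ 2) + (1 - α) * (y u * y v), fun u v => ?_,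
    fun u v => by ring, fun H hH => ?_⟩
  · have := hy u
    have := hy v
    have : 0 < 1 - α := by linarith
    positivity
  · rw [← dotProduct_distanceAlphaMatrix_mulVec, ← dotProduct_distanceAlphaMatrix_mulVec, hy1,
      dotProduct_smul, smul_eq_mul] at hH
    have hpos : 0 < y ⬝ᵥ y := Finset.sum_pos (fun u _ => mul_pos (hy u) (hy u))
      Finset.univ_nonempty
    exact lt_of_mul_lt_mul_right (hH.trans_le (H.dotProduct_distanceAlphaMatrix_mulVec_le α y))
      hpos.le

theorem Reachable.dist_map_le {V W : Type*} {G : SimpleGraph V} {H : SimpleGraph W} (f : G →g H)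
    {u v : V} (h : G.Reachable u v) : H.dist (f u) (f v) ≤ G.dist u v := by
  obtain ⟨p, hp⟩ := h.exists_walk_length_eq_dist
  rw [← hp, ← p.length_map f]
  exact dist_le _

theorem Iso.dist_eq {V W : Type*} {G : SimpleGraph V} {H : SimpleGraph W} (f : G ≃g H) (u v : V) :
    H.dist (f u) (f v) = G.dist u v := by
  by_cases h : G.Reachable u v
  · refine le_antisymm (h.dist_map_le f.toHom) ?_
    simpa using Reachable.dist_map_le f.symm.toHom (f.reachable_iff.2 h)
  · rw [dist_eq_zero_of_not_reachable h,
      dist_eq_zero_of_not_reachable (fun h' => h (f.reachable_iff.1 h'))]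

theorem Iso.distanceAlphaSpectralRadius_eq {W : Type*} [Fintype W] [DecidableEq W]
    {G : SimpleGraph V} {H : SimpleGraph W} (f : G ≃g H) (α : ℝ) :
    G.distanceAlphaSpectralRadius α = H.distanceAlphaSpectralRadius α := by
  have h : H.distanceAlphaMatrix α
      = Matrix.reindexAlgEquiv ℝ ℝ f.toEquiv (G.distanceAlphaMatrix α) := by
    ext i j
    obtain ⟨i, rfl⟩ := f.surjective i
    obtain ⟨j, rfl⟩ := f.surjective j
    have htr : H.transmission (f i) = G.transmission i := by
      unfold transmission
      rw [← f.toEquiv.sum_comp]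
      exact Finset.sum_congr rfl fun v _ => f.dist_eq i v
    simp [distanceAlphaMatrix, transmissionMatrix, distanceMatrix, f.dist_eq,
      Matrix.diagonal_apply, htr]
    change _ = (if i = j then α * (G.transmission (f.symm (f i)) : ℝ) else 0)
      + (1 - α) * (G.dist (f.symm (f i)) (f.symm (f j)) : ℝ)
    rw [f.symm_apply_apply, f.symm_apply_apply]
  unfold distanceAlphaSpectralRadius
  congr 1
  ext μ
  rw [Set.mem_ofPred_eq, Set.mem_ofPred_eq, Module.End.hasEigenvalue_iff_mem_spectrum,
    Module.End.hasEigenvalue_iff_mem_spectrum, Matrix.spectrum_toLin', Matrix.spectrum_toLin', h,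
    AlgEquiv.spectrum_eq]

theorem distanceAlphaSpectralRadius_lt_of_lt [Nontrivial V] {G H : SimpleGraph V} (hlt : H < G)
    (hH : H.Connected) {α : ℝ} (hα₀ : 0 ≤ α) (hα₁ : α < 1) :
    G.distanceAlphaSpectralRadius α < H.distanceAlphaSpectralRadius α := by
  obtain ⟨W, hW, -, h⟩ := exists_weight (hH.mono hlt.le) hα₀ hα₁
  apply h
  have hle : ∀ u v, (G.dist u v : ℝ) * W u v ≤ (H.dist u v : ℝ) * W u v := fun u v =>
    mul_le_mul_of_nonneg_right (by exact_mod_cast (hH u v).dist_anti hlt.le) (hW u v).le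
  obtain ⟨a, b, hab, hnab⟩ : ∃ a b, G.Adj a b ∧ ¬ H.Adj a b := by
    by_contra! hc
    exact hlt.not_ge fun a b => hc a b
  refine Finset.sum_lt_sum (fun u _ => Finset.sum_le_sum fun v _ => hle u v)
    ⟨a, Finset.mem_univ a, Finset.sum_lt_sum (fun v _ => hle a v) ⟨b, Finset.mem_univ b, ?_⟩⟩
  refine mul_lt_mul_of_pos_right ?_ (hW a b)
  rw [dist_eq_one_iff_adj.2 hab]
  exact_mod_cast hH.one_lt_dist_of_ne_of_not_adj hab.ne hnab

end SimpleGraph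

/-! ### Moving an attached set to another vertex -/

namespace SimpleGraph

section Sliding

variable {V : Type*} {G : SimpleGraph V}

/-- The set `A` of vertices is attached at `v` if `v` lies outside `A` and separates `A` from the
other vertices outside `A`. -/
def AttachedAt (G : SimpleGraph V) (A : Set V) (v : V) : Prop :=
  v ∉ A ∧ ∀ y ∈ A, ∀ z ∉ A, G.Adj y z → z = v

/-- The graph obtained from `G` by detaching `A` from `v` and attaching it to `p` instead. -/
def slide (G : SimpleGraph V) (A : Set V) (v p : V) : SimpleGraph V where
  Adj x y := (G.Adj x y ∧ (x ∈ A ↔ y ∈ A)) ∨ (x ∈ A ∧ y ∉ A ∧ y = p ∧ G.Adj x v) ∨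
    (y ∈ A ∧ x ∉ A ∧ x = p ∧ G.Adj y v)
  symm := ⟨fun x y h => by
    rcases h with ⟨h, h'⟩ | h | h
    · exact Or.inl ⟨h.symm, h'.symm⟩
    · exact Or.inr (Or.inr h)
    · exact Or.inr (Or.inl h)⟩
  loopless := ⟨fun x h => by
    rcases h with ⟨h, -⟩ | ⟨h, h', -⟩ | ⟨h, h', -⟩
    · exact h.ne rfl
    · exact h' h
    · exact h' h⟩

/-- Bounds distances below by a potential growing by at most one along each edge, so geodesics of
the modified graph need not be described. -/
theorem le_add_dist_of_forall_adj {H : SimpleGraph V} (hH : H.Connected) {f : V → ℕ}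
    (hf : ∀ y z, H.Adj y z → f z ≤ f y + 1) (y z : V) : f z ≤ f y + H.dist y z := by
  obtain ⟨p, hp⟩ := hH.exists_walk_length_eq_dist y z
  rw [← hp]
  clear hp
  induction p with
  | nil => simp
  | cons h p ih =>
    have := hf _ _ h
    rw [Walk.length_cons]
    omega

theorem Connected.exists_adj_dist_add_one (hG : G.Connected) {v x : V} (h : x ≠ v) :
    ∃ y, G.Adj x y ∧ G.dist y v + 1 = G.dist x v := by
  obtain ⟨p, hp⟩ := hG.exists_walk_length_eq_dist x v
  cases p with
  | nil => exact absurd rfl h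
  | @cons _ y _ hxy q =>
    refine ⟨y, hxy, ?_⟩
    rw [Walk.length_cons] at hp
    have h1 := dist_le q
    have h2 := hG.dist_triangle (u := x) (v := y) (w := v)
    rw [dist_eq_one_iff_adj.2 hxy] at h2
    omega

theorem Adj.dist_le_add_one (hG : G.Connected) {y z : V} (h : G.Adj y z) (x : V) :
    G.dist x z ≤ G.dist x y + 1 := by
  have := hG.dist_triangle (u := x) (v := y) (w := z)
  rwa [dist_eq_one_iff_adj.2 h] at this

theorem AttachedAt.mem_support {A : Set V} {v : V} (hA : G.AttachedAt A v) {a b : V}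
    (p : G.Walk a b) (ha : a ∈ A) (hb : b ∉ A) : v ∈ p.support := by
  induction p with
  | nil => exact absurd ha hb
  | @cons x y z h p ih =>
    rw [Walk.support_cons]
    by_cases hy : y ∈ A
    · exact List.mem_cons_of_mem _ (ih hy hb)
    · have := hA.2 _ ha _ hy h
      subst this
      exact List.mem_cons_of_mem _ p.start_mem_support

theorem AttachedAt.dist_eq (hG : G.Connected) {A : Set V} {v : V} (hA : G.AttachedAt A v) {a b : V}
    (ha : a ∈ A) (hb : b ∉ A) : G.dist a b = G.dist a v + G.dist v b := by
  classical
  refine le_antisymm hG.dist_triangle ?_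
  obtain ⟨p, hp⟩ := hG.exists_walk_length_eq_dist a b
  have hv := hA.mem_support p ha hb
  rw [← hp, ← p.take_spec hv, Walk.length_append]
  exact add_le_add (dist_le _) (dist_le _)

variable {A : Set V} {v p : V}

theorem slide_connected (hG : G.Connected) (hA : G.AttachedAt A v) (hp : p ∉ A) :
    (G.slide A v p).Connected := by
  -- A geodesic to `v` from outside `A` never enters `A`, since only `v` has neighbours there; it
  -- survives the move.
  have h1 : ∀ n, ∀ b ∉ A, G.dist b v = n → (G.slide A v p).Reachable b v := by
    intro n
    induction n with
    | zero =>
      intro b _ h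
      rw [hG.dist_eq_zero_iff.1 h]
    | succ n ih =>
      intro b hb h
      have hbv : b ≠ v := by rintro rfl; simp at h
      obtain ⟨y, hy, hd⟩ := hG.exists_adj_dist_add_one hbv
      have hyA : y ∉ A := fun hyA => hbv (hA.2 y hyA b hb hy.symm)
      have hadj : (G.slide A v p).Adj b y := Or.inl ⟨hy, iff_of_false hb hyA⟩
      exact hadj.reachable.trans (ih y hyA (by omega))
  have h2 : ∀ n, ∀ a ∈ A, G.dist a v = n → (G.slide A v p).Reachable a p := by
    intro n
    induction n with
    | zero =>
      intro a ha h
      rw [hG.dist_eq_zero_iff.1 h] at ha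
      exact absurd ha hA.1
    | succ n ih =>
      intro a ha h
      have hav : a ≠ v := by rintro rfl; exact hA.1 ha
      obtain ⟨y, hy, hd⟩ := hG.exists_adj_dist_add_one hav
      by_cases hyA : y ∈ A
      · have hadj : (G.slide A v p).Adj a y := Or.inl ⟨hy, iff_of_true ha hyA⟩
        exact hadj.reachable.trans (ih y hyA (by omega))
      · have := hA.2 a ha y hyA hy
        subst this
        have hadj : (G.slide A y p).Adj a p := Or.inr (Or.inl ⟨ha, hp, rfl, hy⟩)
        exact hadj.reachable
  have h3 : ∀ x, (G.slide A v p).Reachable x p := fun x => by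
    by_cases hx : x ∈ A
    · exact h2 _ x hx rfl
    · exact (h1 _ x hx rfl).trans (h1 _ p hp rfl).symm
  have : Nonempty V := ⟨v⟩
  exact ⟨fun x y => (h3 x).trans (h3 y).symm⟩

theorem dist_le_dist_slide (hG : G.Connected) (hA : G.AttachedAt A v) (hp : p ∉ A) {x y : V}
    (hxy : x ∈ A ↔ y ∈ A) : G.dist x y ≤ (G.slide A v p).dist x y := by
  classical
  have hH := slide_connected hG hA hp
  by_cases hx : x ∈ A
  -- The potential is the expected distance from `x` after the move: a route leaving `A` now passes
  -- through `v`'s replacement `p`.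
  · have := le_add_dist_of_forall_adj hH
      (f := fun z => if z ∈ A then G.dist x z else G.dist x v + G.dist p z) ?_ x y
    · simpa [hx, hxy.1 hx] using this
    · rintro y z (⟨h, h'⟩ | ⟨h1, h2, rfl, h3⟩ | ⟨h1, h2, rfl, h3⟩)
      · by_cases hy : y ∈ A
        · simpa [hy, h'.1 hy] using h.dist_le_add_one hG x
        · have hz : z ∉ A := fun hz => hy (h'.2 hz)
          simpa [hy, hz, add_assoc] using h.dist_le_add_one hG p
      · simpa [h1, h2] using h3.dist_le_add_one hG x
      · simpa [h1, h2] using h3.symm.dist_le_add_one hG x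
  · have := le_add_dist_of_forall_adj hH
      (f := fun z => if z ∈ A then G.dist x p + G.dist v z else G.dist x z) ?_ x y
    · have hy : y ∉ A := fun h => hx (hxy.2 h)
      simpa [hx, hy] using this
    · rintro y z (⟨h, h'⟩ | ⟨h1, h2, rfl, h3⟩ | ⟨h1, h2, rfl, h3⟩)
      · by_cases hy : y ∈ A
        · simpa [hy, h'.1 hy, add_assoc] using h.dist_le_add_one hG v
        · have hz : z ∉ A := fun hz => hy (h'.2 hz)
          simpa [hy, hz] using h.dist_le_add_one hG x
      · simp only [h1, h2, if_true, if_false]; omega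
      · simp only [h1, h2, if_true, if_false, dist_eq_one_iff_adj.2 h3.symm]; omega

theorem dist_add_dist_le_dist_slide (hG : G.Connected) (hA : G.AttachedAt A v) (hp : p ∉ A)
    {a b : V} (ha : a ∈ A) (hb : b ∉ A) :
    G.dist a v + G.dist p b ≤ (G.slide A v p).dist a b := by
  classical
  have hH := slide_connected hG hA hp
  have := le_add_dist_of_forall_adj hH
      (f := fun z => if z ∈ A then G.dist a z else G.dist a v + G.dist p z) ?_ a b
  · simpa [ha, hb] using this
  · rintro y z (⟨h, h'⟩ | ⟨h1, h2, rfl, h3⟩ | ⟨h1, h2, rfl, h3⟩)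
    · by_cases hy : y ∈ A
      · simpa [hy, h'.1 hy] using h.dist_le_add_one hG a
      · have hz : z ∉ A := fun hz => hy (h'.2 hz)
        simpa [hy, hz, add_assoc] using h.dist_le_add_one hG p
    · simpa [h1, h2] using h3.dist_le_add_one hG a
    · simpa [h1, h2] using h3.symm.dist_le_add_one hG a

open Classical in
/-- The change of the distance between `x` and `y` when `A`, which contains `x` but not `y`, is
moved from `v` to `p`. -/
noncomputable def slideGain (G : SimpleGraph V) (A : Set V) (v p x y : V) : ℝ :=
  if x ∈ A ∧ y ∉ A then (G.dist p y : ℝ) - G.dist v y else 0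

theorem dist_add_slideGain_le (hG : G.Connected) (hA : G.AttachedAt A v) (hp : p ∉ A) (x y : V) :
    (G.dist x y : ℝ) + (G.slideGain A v p x y + G.slideGain A v p y x)
      ≤ (G.slide A v p).dist x y := by
  by_cases hx : x ∈ A <;> by_cases hy : y ∈ A
  · simpa [slideGain, hx, hy] using dist_le_dist_slide hG hA hp (iff_of_true hx hy)
  · have h : (G.dist x v : ℝ) + G.dist p y ≤ (G.slide A v p).dist x y := by
      exact_mod_cast dist_add_dist_le_dist_slide hG hA hp hx hy
    have h2 : (G.dist x y : ℝ) ≤ G.dist x v + G.dist v y := by exact_mod_cast hG.dist_triangle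
    simp only [slideGain, hx, hy, not_true, not_false_iff, and_true, and_false, if_true, if_false]
    linarith
  · have h : (G.dist y v : ℝ) + G.dist p x ≤ (G.slide A v p).dist y x := by
      exact_mod_cast dist_add_dist_le_dist_slide hG hA hp hy hx
    have h2 : (G.dist y x : ℝ) ≤ G.dist y v + G.dist v x := by exact_mod_cast hG.dist_triangle
    rw [dist_comm] at h2
    rw [(G.slide A v p).dist_comm] at h
    simp only [slideGain, hx, hy, not_true, not_false_iff, and_true, and_false, if_true, if_false]
    linarith
  · simpa [slideGain, hx, hy] using dist_le_dist_slide hG hA hp (iff_of_false hx hy)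

/-- Moving a set `A` attached at `v` to one of two vertices separated by `v` increases the
distance `α`-spectral radius. -/
theorem distanceAlphaSpectralRadius_lt_slide [Fintype V] [DecidableEq V] (hG : G.Connected)
    (hA : G.AttachedAt A v) (hne : A.Nonempty) {q : V} (hp : p ∉ A) (hq : q ∉ A)
    (hpv : p ≠ v) (hqv : q ≠ v)
    (hpq : ∀ b ∉ A, G.dist p b = G.dist p v + G.dist v b ∨ G.dist q b = G.dist q v + G.dist v b)
    {α : ℝ} (hα₀ : 0 ≤ α) (hα₁ : α < 1) :
    G.distanceAlphaSpectralRadius α < (G.slide A v p).distanceAlphaSpectralRadius α ∨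
      G.distanceAlphaSpectralRadius α < (G.slide A v q).distanceAlphaSpectralRadius α := by
  have : Nontrivial V := ⟨p, v, hpv⟩
  obtain ⟨W, hW, hsymm, hlt⟩ := exists_weight hG hα₀ hα₁
  -- As `W` is symmetric, the gains of `(x, y)` and `(y, x)` contribute equal sums, so positivity of
  -- one suffices.
  have key : ∀ s ∉ A, 0 < ∑ x, ∑ y, G.slideGain A v s x y * W x y →
      G.distanceAlphaSpectralRadius α < (G.slide A v s).distanceAlphaSpectralRadius α := by
    intro s hs hpos
    apply hlt
    have h1 : ∑ x, ∑ y, G.slideGain A v s y x * W x y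
        = ∑ x, ∑ y, G.slideGain A v s x y * W x y := by
      rw [Finset.sum_comm]
      exact Finset.sum_congr rfl fun x _ => Finset.sum_congr rfl fun y _ => by rw [hsymm]
    have h2 : ∑ x, ∑ y, ((G.dist x y : ℝ) * W x y + (G.slideGain A v s x y * W x y
        + G.slideGain A v s y x * W x y)) ≤ ∑ x, ∑ y, ((G.slide A v s).dist x y : ℝ) * W x y := by
      refine Finset.sum_le_sum fun x _ => Finset.sum_le_sum fun y _ => ?_
      have := mul_le_mul_of_nonneg_right (dist_add_slideGain_le hG hA hs x y) (hW x y).le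
      linarith
    simp only [Finset.sum_add_distrib] at h2
    linarith
  have hP : (0 : ℝ) < G.dist p v := by exact_mod_cast hG.pos_dist_of_ne hpv
  have hQ : (0 : ℝ) < G.dist q v := by exact_mod_cast hG.pos_dist_of_ne hqv
  obtain ⟨a, ha⟩ := hne
  -- If `v` separates `y` from `p`, moving to `p` gains exactly `d(p,v)`, while moving to `q` loses
  -- at most `d(q,v)`; the crossed weights make these cancel. The other case is symmetric.
  have hterm : ∀ x y, 0 ≤ ((G.dist q v : ℝ) * G.slideGain A v p x y
      + G.dist p v * G.slideGain A v q x y) * W x y := by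
    intro x y
    refine mul_nonneg ?_ (hW x y).le
    unfold slideGain
    split_ifs with h
    · have tp : (G.dist v y : ℝ) ≤ G.dist p v + G.dist p y := by
        rw [G.dist_comm (u := p) (v := v)]
        exact_mod_cast hG.dist_triangle
      have tq : (G.dist v y : ℝ) ≤ G.dist q v + G.dist q y := by
        rw [G.dist_comm (u := q) (v := v)]
        exact_mod_cast hG.dist_triangle
      rcases hpq y h.2 with e | e
      · have e' : (G.dist p y : ℝ) = G.dist p v + G.dist v y := by exact_mod_cast e
        rw [e']
        nlinarith
      · have e' : (G.dist q y : ℝ) = G.dist q v + G.dist v y := by exact_mod_cast e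
        rw [e']
        nlinarith
    · simp
  have hsum : 0 < ∑ x, ∑ y, ((G.dist q v : ℝ) * G.slideGain A v p x y
      + G.dist p v * G.slideGain A v q x y) * W x y := by
    -- Strictness comes from the pair `(a, v)`, which gains under both moves.
    refine Finset.sum_pos' (fun x _ => Finset.sum_nonneg fun y _ => hterm x y)
      ⟨a, Finset.mem_univ a, Finset.sum_pos' (fun y _ => hterm a y) ⟨v, Finset.mem_univ v, ?_⟩⟩
    refine mul_pos ?_ (hW a v)
    simp only [slideGain, ha, hA.1, not_false_iff, and_self, if_true, dist_self, Nat.cast_zero,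
      sub_zero]
    positivity
  have hsplit : ∑ x, ∑ y, ((G.dist q v : ℝ) * G.slideGain A v p x y
      + G.dist p v * G.slideGain A v q x y) * W x y
      = G.dist q v * ∑ x, ∑ y, G.slideGain A v p x y * W x y
        + G.dist p v * ∑ x, ∑ y, G.slideGain A v q x y * W x y := by
    simp only [Finset.mul_sum, ← Finset.sum_add_distrib]
    exact Finset.sum_congr rfl fun x _ => Finset.sum_congr rfl fun y _ => by ring
  by_contra! hcon
  have c1 := not_lt.1 (mt (key p hp) hcon.1.not_gt)
  have c2 := not_lt.1 (mt (key q hq) hcon.2.not_gt)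
  rw [hsplit] at hsum
  have := mul_nonneg hQ.le (neg_nonneg.2 c1)
  have := mul_nonneg hP.le (neg_nonneg.2 c2)
  linarith

theorem neighborSet_slide_self (hA : G.AttachedAt A v) (hpv : p ≠ v) :
    (G.slide A v p).neighborSet v = G.neighborSet v \ A := by
  ext y
  simp only [mem_neighborSet, slide, Set.mem_sdiff, hA.1, false_iff, false_and,
    not_false_iff, hpv.symm, and_false, or_false]

theorem neighborSet_slide_target (hA : G.AttachedAt A v) (hp : p ∉ A) (hpv : p ≠ v) :
    (G.slide A v p).neighborSet p = G.neighborSet p ∪ (G.neighborSet v ∩ A) := by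
  ext y
  have : G.Adj p y → y ∉ A := fun h hy => hpv (hA.2 y hy p hp h.symm)
  simp only [mem_neighborSet, slide, Set.mem_union, Set.mem_inter_iff, hp, G.adj_comm y v]
  tauto

theorem ncard_neighborSet_slide [Finite V] (hA : G.AttachedAt A v) (hp : p ∉ A) (hpv : p ≠ v)
    {x : V} (hxv : x ≠ v) (hxp : x ≠ p) :
    ((G.slide A v p).neighborSet x).ncard = (G.neighborSet x).ncard := by
  classical
  by_cases hx : x ∈ A
  · have h : (G.slide A v p).neighborSet x = Equiv.swap v p '' G.neighborSet x := by
      ext y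
      have hxp' : ¬ G.Adj x p := fun h => hpv (hA.2 x hx p hp h)
      rw [Equiv.image_eq_preimage_symm]
      simp only [mem_neighborSet, slide, Set.mem_preimage, Equiv.symm_swap, hx, true_iff, true_and,
        not_true, false_and, and_false, or_false]
      by_cases h1 : y = v
      · subst h1
        simp [hA.1, hxp', hpv.symm]
      · by_cases h2 : y = p
        · subst h2
          simp [hp]
        · rw [Equiv.swap_apply_of_ne_of_ne h1 h2]
          have : G.Adj x y → y ∈ A := fun h => by_contra fun hy => h1 (hA.2 x hx y hy h)
          tauto
    rw [h, Set.ncard_image_of_injective _ (Equiv.injective _)]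
  · congr 1
    ext y
    have : G.Adj x y → y ∉ A := fun h hy => hxv (hA.2 y hy x hx h.symm)
    simp only [mem_neighborSet, slide]
    tauto

end Sliding

end SimpleGraph

/-! ### Branches of a tree at a vertex -/

namespace SimpleGraph

section Branches

variable {V : Type*} {G : SimpleGraph V}

/-- The vertices that can be reached from `w` without passing through `v`. -/
def branch (G : SimpleGraph V) (v w : V) : Set V :=
  {x | (G.deleteIncidenceSet v).Reachable w x}

theorem mem_branch_self (v w : V) : w ∈ G.branch v w := Reachable.refl w

theorem notMem_branch {v w : V} (h : w ≠ v) : v ∉ G.branch v w := by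
  rintro ⟨p⟩
  cases p.reverse with
  | nil => exact h rfl
  | cons hadj _ => exact (deleteIncidenceSet_adj.1 hadj).2.1 rfl

theorem mem_branch_of_adj {v w x y : V} (hx : x ∈ G.branch v w) (hxy : G.Adj x y) (hxv : x ≠ v)
    (hyv : y ≠ v) : y ∈ G.branch v w :=
  Reachable.trans hx (deleteIncidenceSet_adj.2 ⟨hxy, hxv, hyv⟩ : (G.deleteIncidenceSet v).Adj x y).reachable

theorem attachedAt_branch {v w : V} (h : w ≠ v) : G.AttachedAt (G.branch v w) v := by
  refine ⟨notMem_branch h, fun y hy z hz hyz => ?_⟩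
  by_contra hzv
  exact hz (mem_branch_of_adj hy hyz (fun e => notMem_branch h (e ▸ hy)) hzv)

/-- Two neighbours sharing a branch would give a detour around the edge `v w₁`, which is a bridge.
-/
theorem IsAcyclic.eq_of_mem_branch (hG : G.IsAcyclic) {v w₁ w₂ x : V} (h₁ : G.Adj v w₁)
    (h₂ : G.Adj v w₂) (hx₁ : x ∈ G.branch v w₁) (hx₂ : x ∈ G.branch v w₂) : w₁ = w₂ := by
  by_contra hne
  have hb := isAcyclic_iff_forall_adj_isBridge.1 hG h₁
  rw [isBridge_iff] at hb
  have hle : G.deleteIncidenceSet v ≤ G.deleteEdges {s(v, w₁)} := by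
    intro a b hab
    rw [deleteIncidenceSet_adj] at hab
    rw [deleteEdges_adj]
    refine ⟨hab.1, ?_⟩
    simp only [Set.mem_singleton_iff, Sym2.eq_iff]
    tauto
  have h3 : (G.deleteEdges {s(v, w₁)}).Adj v w₂ := by
    rw [deleteEdges_adj]
    refine ⟨h₂, ?_⟩
    simp only [Set.mem_singleton_iff, Sym2.eq_iff]
    rintro (⟨-, h⟩ | ⟨-, h⟩)
    · exact hne h.symm
    · exact h₂.ne h.symm
  exact hb (h3.reachable.trans ((Reachable.mono hle hx₂).trans (Reachable.mono hle hx₁).symm))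

/-- Uniqueness of the parent in the tree rooted at `v`: it is the penultimate vertex of the path
from `v` to `x`. -/
theorem IsTree.eq_of_adj_of_dist_lt (hG : G.IsTree) {v x y₁ y₂ : V} (h₁ : G.Adj x y₁)
    (h₂ : G.Adj x y₂) (hd₁ : G.dist v y₁ < G.dist v x) (hd₂ : G.dist v y₂ < G.dist v x) :
    y₁ = y₂ := by
  obtain ⟨p, hp, hpl⟩ := hG.connected.exists_path_of_dist v x
  have key : ∀ y, G.Adj x y → G.dist v y < G.dist v x → y = p.penultimate := by
    intro y hy hd
    refine hG.isAcyclic.eq_penultimate_of_adj_end hp hy ?_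
    obtain ⟨q, hq, hql⟩ := hG.connected.exists_path_of_dist v y
    refine hG.isAcyclic.mem_support_of_ne_mem_support_of_adj_of_isPath hp hq hy fun hx => ?_
    classical
    have := dist_le (q.takeUntil x hx)
    have := q.length_takeUntil_le_length hx
    omega
  rw [key y₁ h₁ hd₁, key y₂ h₂ hd₂]

theorem IsTree.ncard_neighborSet_le_one [Finite V] (hG : G.IsTree) {v x : V}
    (h : ∀ y, G.Adj x y → G.dist v y ≤ G.dist v x) : (G.neighborSet x).ncard ≤ 1 := by
  rw [Set.ncard_le_one]
  intro a ha b hb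
  exact hG.eq_of_adj_of_dist_lt ha hb
    ((h a ha).lt_of_ne (hG.dist_ne_of_adj v ha).symm)
    ((h b hb).lt_of_ne (hG.dist_ne_of_adj v hb).symm)

theorem IsTree.exists_mem_branch_ncard_neighborSet_le_one [Finite V] (hG : G.IsTree) {v w : V}
    (h : w ≠ v) : ∃ x ∈ G.branch v w, (G.neighborSet x).ncard ≤ 1 := by
  -- A vertex of the branch farthest from `v` has no children.
  obtain ⟨x, hx, hmax⟩ := (Set.toFinite (G.branch v w)).exists_maximalFor (G.dist v) _
    ⟨w, mem_branch_self v w⟩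
  refine ⟨x, hx, hG.ncard_neighborSet_le_one (v := v) fun y hy => ?_⟩
  by_cases hyv : y = v
  · subst hyv; simp
  · by_contra! hlt
    exact absurd (hmax (mem_branch_of_adj hx hy (fun e => notMem_branch h (e ▸ hx)) hyv) hlt.le)
      (by omega)

theorem IsTree.dist_eq_or_dist_eq (hG : G.IsTree) {v b c p q : V} (hb : G.Adj v b)
    (hc : G.Adj v c) (hbc : b ≠ c) (hp : p ∈ G.branch v b) (hq : q ∈ G.branch v c) (x : V) :
    G.dist p x = G.dist p v + G.dist v x ∨ G.dist q x = G.dist q v + G.dist v x := by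
  by_cases hx : x ∈ G.branch v b
  · refine Or.inr ((attachedAt_branch hc.ne').dist_eq hG.connected hq fun hx' => ?_)
    exact hbc (hG.isAcyclic.eq_of_mem_branch hb hc hx hx')
  · exact Or.inl ((attachedAt_branch hb.ne').dist_eq hG.connected hp hx)

/-- Applied to the star of all edges at `u`, so that a spanning tree can be chosen to contain it. -/
theorem isAcyclic_of_forall_adj_imp {V : Type*} {H : SimpleGraph V} (u : V)
    (h : ∀ a b, H.Adj a b → a = u ∨ b = u) : H.IsAcyclic := by
  have key : ∀ w, w ≠ u → ¬ (H.deleteEdges {s(w, u)}).Reachable w u := by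
    rintro w hw ⟨p⟩
    cases p with
    | nil => exact hw rfl
    | cons hadj _ =>
      rw [deleteEdges_adj] at hadj
      rcases h _ _ hadj.1 with e | e
      · exact hw e
      · subst e; exact hadj.2 rfl
  rw [isAcyclic_iff_forall_adj_isBridge]
  intro a b hab
  rw [isBridge_iff]
  rcases h a b hab with rfl | rfl
  · rw [Sym2.eq_swap]
    exact fun hr => key b hab.ne' hr.symm
  · exact key a hab.ne

end Branches

/-! ### Structure of the maximizers -/

section Extremal

variable {V : Type*} [Fintype V] [DecidableEq V]

/-- Connected graphs with maximum degree `Δ`. -/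
def ConnectedMaxDegree (Δ : ℕ) (G : SimpleGraph V) : Prop :=
  G.Connected ∧ (∀ x, (G.neighborSet x).ncard ≤ Δ) ∧ ∃ u, (G.neighborSet u).ncard = Δ

/-- Graphs of largest distance `α`-spectral radius among the connected graphs on the same vertices
with maximum degree `Δ`. -/
def IsMaximizer (Δ : ℕ) (α : ℝ) (G : SimpleGraph V) : Prop :=
  G.ConnectedMaxDegree Δ ∧ ∀ H : SimpleGraph V, H.ConnectedMaxDegree Δ →
    H.distanceAlphaSpectralRadius α ≤ G.distanceAlphaSpectralRadius α

theorem IsMaximizer.isTree {G : SimpleGraph V} [Nontrivial V] {Δ : ℕ} {α : ℝ} (hα₀ : 0 ≤ α)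
    (hα₁ : α < 1) (hG : G.IsMaximizer Δ α) : G.IsTree := by
  obtain ⟨⟨hc, hle, u, hu⟩, hmax⟩ := hG
  let S : SimpleGraph V :=
    { Adj := fun a b => G.Adj a b ∧ (a = u ∨ b = u)
      symm := ⟨fun a b h => ⟨h.1.symm, h.2.symm⟩⟩
      loopless := ⟨fun a h => h.1.ne rfl⟩ }
  have hS : S ≤ G := fun a b h => h.1
  -- A spanning tree keeping every edge at `u` still has maximum degree `Δ`.
  obtain ⟨T, hST, hTG, hT⟩ := hc.exists_isTree_le_of_le_of_isAcyclic hS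
    (isAcyclic_of_forall_adj_imp u fun a b h => h.2)
  have hTcl : T.ConnectedMaxDegree Δ := by
    refine ⟨hT.connected, fun x => (Set.ncard_le_ncard fun y hy => hTG hy).trans (hle x), u, ?_⟩
    rw [← hu]
    congr 1
    ext y
    exact ⟨fun h => hTG h, fun h => hST ⟨h, Or.inl rfl⟩⟩
  rcases hTG.eq_or_lt with rfl | hlt
  · exact hT
  · exact absurd (distanceAlphaSpectralRadius_lt_of_lt hlt hT.connected hα₀ hα₁)
      (hmax T hTcl).not_gt

theorem IsMaximizer.not_connectedMaxDegree_slide {G : SimpleGraph V} {Δ : ℕ} {α : ℝ}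
    (hα₀ : 0 ≤ α) (hα₁ : α < 1) (hG : G.IsMaximizer Δ α) {A : Set V} {v b c p q : V}
    (hA : G.AttachedAt A v) (hne : A.Nonempty) (hb : G.Adj v b) (hc : G.Adj v c) (hbc : b ≠ c)
    (hp : p ∈ G.branch v b) (hq : q ∈ G.branch v c) (hpA : p ∉ A) (hqA : q ∉ A)
    (hpc : (G.slide A v p).ConnectedMaxDegree Δ) : ¬ (G.slide A v q).ConnectedMaxDegree Δ := by
  intro hqc
  have : Nontrivial V := ⟨v, b, hb.ne⟩
  have hT := hG.isTree hα₀ hα₁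
  rcases distanceAlphaSpectralRadius_lt_slide hT.connected hA hne hpA hqA
    (fun e => notMem_branch hb.ne' (e ▸ hp)) (fun e => notMem_branch hc.ne' (e ▸ hq))
    (fun x _ => hT.dist_eq_or_dist_eq hb hc hbc hp hq x) hα₀ hα₁ with h | h
  · exact absurd h (hG.2 _ hpc).not_gt
  · exact absurd h (hG.2 _ hqc).not_gt

/-- With three neighbours `a`, `b`, `c` of `v`, the branch of `a` can move to a leaf in the branch
of `b` or of `c`. That leaf gets degree at most `2 ≤ Δ`, and `u`, being neither `v` nor a leaf,
keeps degree `Δ`. -/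
theorem IsMaximizer.ncard_neighborSet_le_two {G : SimpleGraph V} {Δ : ℕ} {α : ℝ} (hα₀ : 0 ≤ α)
    (hα₁ : α < 1) (hΔ : 2 ≤ Δ) (hG : G.IsMaximizer Δ α) {u v : V}
    (hu : (G.neighborSet u).ncard = Δ) (hv : v ≠ u) : (G.neighborSet v).ncard ≤ 2 := by
  have : Nontrivial V := ⟨v, u, hv⟩
  have hT := hG.isTree hα₀ hα₁
  by_contra! h3
  obtain ⟨a, ha, b, hb, c, hc, hab, hac, hbc⟩ := (Set.two_lt_ncard (Set.toFinite _)).1 h3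
  rw [mem_neighborSet] at ha hb hc
  obtain ⟨p, hp, hp1⟩ := hT.exists_mem_branch_ncard_neighborSet_le_one hb.ne'
  obtain ⟨q, hq, hq1⟩ := hT.exists_mem_branch_ncard_neighborSet_le_one hc.ne'
  have hA := attachedAt_branch (G := G) ha.ne'
  have key : ∀ w r, G.Adj v w → a ≠ w → r ∈ G.branch v w → (G.neighborSet r).ncard ≤ 1 →
      r ∉ G.branch v a ∧ (G.slide (G.branch v a) v r).ConnectedMaxDegree Δ := by
    intro w r hw haw hr hr1
    have hrA : r ∉ G.branch v a := fun h => haw (hT.isAcyclic.eq_of_mem_branch ha hw h hr)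
    have hrv : r ≠ v := fun e => notMem_branch hw.ne' (e ▸ hr)
    refine ⟨hrA, slide_connected hT.connected hA hrA, fun x => ?_, u, ?_⟩
    · by_cases hxv : x = v
      · subst hxv
        rw [neighborSet_slide_self hA hrv]
        exact (Set.ncard_le_ncard Set.sdiff_subset).trans (hG.1.2.1 x)
      · by_cases hxr : x = r
        · subst hxr
          rw [neighborSet_slide_target hA hrA hrv]
          have h1 : G.neighborSet v ∩ G.branch v a ⊆ {a} := fun y hy =>
            (hT.isAcyclic.eq_of_mem_branch ha hy.1 hy.2 (mem_branch_self v y)).symm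
          have h2 := Set.ncard_le_ncard h1
          rw [Set.ncard_singleton] at h2
          have h3 := Set.ncard_union_le (G.neighborSet x) (G.neighborSet v ∩ G.branch v a)
          omega
        · rw [ncard_neighborSet_slide hA hrA hrv hxv hxr]
          exact hG.1.2.1 x
    · rw [ncard_neighborSet_slide hA hrA hrv hv.symm, hu]
      rintro rfl
      omega
  obtain ⟨hpA, hpc⟩ := key b p hb hab hp hp1
  obtain ⟨hqA, hqc⟩ := key c q hc hac hq hq1
  exact hG.not_connectedMaxDegree_slide hα₀ hα₁ hA ⟨a, mem_branch_self v a⟩ hb hc hbc hp hq hpA hqA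
    hpc hqc

/-- Otherwise all other branches at `u` can move to `b` or to `c`. The target has degree exactly 2
and receives `Δ - 2` neighbours, so it takes over the role of the vertex of degree `Δ`; `Δ ≥ 3`
gives something to move. -/
theorem IsMaximizer.eq_of_two_le_ncard_neighborSet {G : SimpleGraph V} {Δ : ℕ} {α : ℝ}
    (hα₀ : 0 ≤ α) (hα₁ : α < 1) (hΔ : 3 ≤ Δ) (hG : G.IsMaximizer Δ α) {u b c : V}
    (hu : (G.neighborSet u).ncard = Δ) (hb : G.Adj u b) (hc : G.Adj u c)
    (hb2 : 2 ≤ (G.neighborSet b).ncard) (hc2 : 2 ≤ (G.neighborSet c).ncard) : b = c := by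
  have : Nontrivial V := ⟨u, b, hb.ne⟩
  have hT := hG.isTree hα₀ hα₁
  by_contra hbc
  set A : Set V := {x | x ≠ u ∧ x ∉ G.branch u b ∧ x ∉ G.branch u c} with hAdef
  have hA : G.AttachedAt A u := by
    refine ⟨fun h => h.1 rfl, fun y hy z hz hyz => ?_⟩
    by_contra hzu
    have hz' : z ∈ G.branch u b ∨ z ∈ G.branch u c := by
      by_contra! h
      exact hz ⟨hzu, h⟩
    rcases hz' with h | h
    · exact hy.2.1 (mem_branch_of_adj h hyz.symm hzu hy.1)
    · exact hy.2.2 (mem_branch_of_adj h hyz.symm hzu hy.1)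
  have hNA : G.neighborSet u ∩ A = G.neighborSet u \ {b, c} := by
    ext y
    simp only [Set.mem_inter_iff, mem_neighborSet, Set.mem_sdiff, Set.mem_insert_iff,
      Set.mem_singleton_iff, not_or]
    refine and_congr_right fun hy => ⟨fun h => ⟨?_, ?_⟩, fun h => ⟨hy.ne', fun h' => ?_, fun h' => ?_⟩⟩
    · rintro rfl; exact h.2.1 (mem_branch_self u y)
    · rintro rfl; exact h.2.2 (mem_branch_self u y)
    · exact h.1 (hT.isAcyclic.eq_of_mem_branch hy hb (mem_branch_self u y) h')
    · exact h.2 (hT.isAcyclic.eq_of_mem_branch hy hc (mem_branch_self u y) h')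
  have hNAc : (G.neighborSet u ∩ A).ncard = Δ - 2 := by
    rw [hNA, Set.ncard_sdiff, hu, Set.ncard_pair hbc]
    rintro y (rfl | rfl)
    · exact hb
    · exact hc
  have hne : A.Nonempty := by
    have : (G.neighborSet u ∩ A).Nonempty := by
      rw [← Set.ncard_pos]; omega
    exact this.mono Set.inter_subset_right
  have hbA : b ∉ A := fun h => h.2.1 (mem_branch_self u b)
  have hcA : c ∉ A := fun h => h.2.2 (mem_branch_self u c)
  have key : ∀ r, G.Adj u r → r ∉ A → 2 ≤ (G.neighborSet r).ncard →
      (G.slide A u r).ConnectedMaxDegree Δ := by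
    intro r hr hrA hr2
    have hr2' := hG.ncard_neighborSet_le_two hα₀ hα₁ (by omega) hu hr.ne'
    have hrdeg : ((G.slide A u r).neighborSet r).ncard = Δ := by
      rw [neighborSet_slide_target hA hrA hr.ne', Set.ncard_union_eq, hNAc]
      · omega
      · rw [Set.disjoint_left]
        exact fun y hy hyA => hr.ne' (hA.2 y hyA.2 r hrA (G.adj_symm hy))
    refine ⟨slide_connected hT.connected hA hrA, fun x => ?_, r, hrdeg⟩
    by_cases hxu : x = u
    · subst hxu
      rw [neighborSet_slide_self hA hr.ne']
      exact (Set.ncard_le_ncard Set.sdiff_subset).trans (hG.1.2.1 x)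
    · by_cases hxr : x = r
      · rw [hxr, hrdeg]
      · rw [ncard_neighborSet_slide hA hrA hr.ne' hxu hxr]
        exact hG.1.2.1 x
  exact hG.not_connectedMaxDegree_slide hα₀ hα₁ hA hne hb hc hbc (mem_branch_self u b)
    (mem_branch_self u c) hbA hcA (key b hb hbA hb2) (key c hc hcA hc2)

end Extremal

end SimpleGraph

/-! ### Recognizing the broom -/

namespace SimpleGraph

section Broom

variable {V : Type*}

theorem broomGraph_adj {n Δ : ℕ} {i j : Fin n} : (broomGraph n Δ).Adj i j ↔ i ≠ j ∧
    (((i.val + 1 = j.val ∧ j.val ≤ n - Δ) ∨ (i.val = n - Δ ∧ n - Δ < j.val)) ∨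
      ((j.val + 1 = i.val ∧ i.val ≤ n - Δ) ∨ (j.val = n - Δ ∧ n - Δ < i.val))) :=
  Iff.rfl

theorem broomGraph_connected {n Δ : ℕ} (hn : 0 < n) (hΔ : 0 < Δ) : (broomGraph n Δ).Connected := by
  have hm : n - Δ < n := by omega
  have h1 : ∀ k, ∀ i : Fin n, i.val + k = n - Δ → (broomGraph n Δ).Reachable i ⟨n - Δ, hm⟩ := by
    intro k
    induction k with
    | zero =>
      intro i hi
      have : i = ⟨n - Δ, hm⟩ := Fin.ext (by simpa using hi)
      rw [this]
    | succ k ih =>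
      intro i hi
      have hadj : (broomGraph n Δ).Adj i ⟨i.val + 1, by omega⟩ := by
        rw [broomGraph_adj]
        refine ⟨fun h => ?_, Or.inl (Or.inl ⟨rfl, ?_⟩)⟩
        · have := congrArg Fin.val h
          simp at this
        · change i.val + 1 ≤ n - Δ
          omega
      refine hadj.reachable.trans (ih _ ?_)
      change i.val + 1 + k = n - Δ
      omega
  have h2 : ∀ i : Fin n, (broomGraph n Δ).Reachable i ⟨n - Δ, hm⟩ := by
    intro i
    by_cases hi : i.val ≤ n - Δ
    · exact h1 (n - Δ - i.val) i (by omega)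
    · have hadj : (broomGraph n Δ).Adj i ⟨n - Δ, hm⟩ := by
        rw [broomGraph_adj]
        refine ⟨fun h => ?_, Or.inr (Or.inr ⟨rfl, by omega⟩)⟩
        rw [h] at hi
        exact hi le_rfl
      exact hadj.reachable
  have : Nonempty (Fin n) := ⟨⟨n - Δ, hm⟩⟩
  exact ⟨fun i j => (h2 i).trans (h2 j).symm⟩

theorem eq_of_ncard_neighborSet_le_two [Finite V] {G : SimpleGraph V} {x a b c : V}
    (h : (G.neighborSet x).ncard ≤ 2) (ha : G.Adj x a) (hb : G.Adj x b) (hc : G.Adj x c)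
    (hab : a ≠ b) (hac : a ≠ c) : b = c := by
  by_contra hbc
  have := (Set.two_lt_ncard (Set.toFinite (G.neighborSet x))).2
    ⟨a, ha, b, hb, c, hc, hab, hac, hbc⟩
  omega

theorem two_le_ncard_neighborSet [Finite V] {G : SimpleGraph V} {x a b : V}
    (ha : G.Adj x a) (hb : G.Adj x b) (hab : a ≠ b) : 2 ≤ (G.neighborSet x).ncard :=
  (Set.one_lt_ncard (Set.toFinite (G.neighborSet x))).2 ⟨a, ha, b, hb, hab⟩

/-- A tree whose vertices other than `u` have degree at most two, and in which at most one
neighbour of `u` is not a leaf, consists of the neighbours of `u` and one geodesic. -/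
theorem IsTree.exists_geodesic [Finite V] {G : SimpleGraph V} (hT : G.IsTree) {u : V}
    (hu : (G.neighborSet u).Nonempty) (h2 : ∀ v, v ≠ u → (G.neighborSet v).ncard ≤ 2)
    (h1 : ∀ b c, G.Adj u b → G.Adj u c → 2 ≤ (G.neighborSet b).ncard →
      2 ≤ (G.neighborSet c).ncard → b = c) :
    ∃ (m : ℕ) (y : ℕ → V), 0 < m ∧ y 0 = u ∧ (∀ i ≤ m, G.dist u (y i) = i) ∧
      (∀ i < m, G.Adj (y i) (y (i + 1))) ∧ ∀ z, G.Adj u z ∨ ∃ i ≤ m, z = y i := by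
  have : Nonempty V := ⟨u⟩
  obtain ⟨x, hx⟩ := Finite.exists_max (G.dist u)
  obtain ⟨p, hp⟩ := hT.connected.exists_walk_length_eq_dist u x
  have hm : 0 < G.dist u x := by
    obtain ⟨w, hw⟩ := hu
    have := hx w
    rw [dist_eq_one_iff_adj.2 hw] at this
    omega
  have hadj : ∀ i < G.dist u x, G.Adj (p.getVert i) (p.getVert (i + 1)) := fun i hi =>
    p.adj_getVert_succ (by omega)
  have hdist : ∀ i ≤ G.dist u x, G.dist u (p.getVert i) = i := by
    intro i hi
    have e1 := dist_le (p.take i)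
    have e2 := dist_le (p.drop i)
    have e3 := hT.connected.dist_triangle (u := u) (v := p.getVert i) (w := x)
    rw [Walk.take_length] at e1
    rw [Walk.drop_length] at e2
    omega
  have hne : ∀ {a b : V}, G.dist u a ≠ G.dist u b → a ≠ b := fun h e => h (e ▸ rfl)
  -- From distance 2 on, each level is a single vertex: its parent is the unique non-leaf neighbour
  -- of `u`, or by induction the previous vertex of the geodesic, and has only one child.
  have hlevel : ∀ k, ∀ z, G.dist u z = k + 2 → z = p.getVert (k + 2) := by
    intro k
    induction k with
    | zero =>
      intro z hz
      have hzx := hx z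
      obtain ⟨w, hw, hwd⟩ := hT.connected.exists_adj_dist_add_one (v := u) (x := z)
        (by rintro rfl; simp at hz)
      rw [dist_comm, dist_comm (u := z)] at hwd
      have huw : G.Adj u w := dist_eq_one_iff_adj.1 (by omega)
      have hu1 : G.Adj u (p.getVert 1) := by simpa using hadj 0 hm
      have h12 := hadj 1 (by omega)
      have hd2 := hdist 2 (by omega)
      have hw1 : w = p.getVert 1 := by
        refine h1 _ _ huw hu1 (two_le_ncard_neighborSet huw.symm hw.symm ?_)
          (two_le_ncard_neighborSet hu1.symm h12 ?_)
        · rintro rfl; simp at hz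
        · exact hne (by simp [hd2])
      subst hw1
      refine eq_of_ncard_neighborSet_le_two (h2 _ hu1.ne') hu1.symm hw.symm h12 ?_ ?_
      · rintro rfl; simp at hz
      · exact hne (by simp [hd2])
    | succ k ih =>
      intro z hz
      have hzx := hx z
      obtain ⟨w, hw, hwd⟩ := hT.connected.exists_adj_dist_add_one (v := u) (x := z)
        (by rintro rfl; simp at hz)
      rw [dist_comm, dist_comm (u := z)] at hwd
      have hwk := ih w (by omega)
      subst hwk
      have hprev := hadj (k + 1) (by omega)
      have hnext := hadj (k + 2) (by omega)
      have d1 := hdist (k + 1) (by omega)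
      have d3 := hdist (k + 1 + 2) (by omega)
      refine eq_of_ncard_neighborSet_le_two (h2 _ ?_) hprev.symm hw.symm hnext ?_ ?_
      · rintro e
        rw [e] at hwd
        simp at hwd
        omega
      · exact hne (by omega)
      · exact hne (by omega)
  refine ⟨G.dist u x, p.getVert, hm, p.getVert_zero, hdist, hadj, fun z => ?_⟩
  rcases h : G.dist u z with _ | _ | k
  · exact Or.inr ⟨0, Nat.zero_le _, by
      rw [p.getVert_zero]; exact (hT.connected.dist_eq_zero_iff.1 h).symm⟩
  · exact Or.inl (dist_eq_one_iff_adj.1 h)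
  · exact Or.inr ⟨k + 2, h ▸ hx z, hlevel k z h⟩

theorem IsTree.nonempty_iso_broomGraph [Fintype V] {G : SimpleGraph V} (hT : G.IsTree) {u : V}
    {n Δ : ℕ} (hn : Fintype.card V = n) (hΔ : 0 < Δ) (hu : (G.neighborSet u).ncard = Δ)
    (h2 : ∀ v, v ≠ u → (G.neighborSet v).ncard ≤ 2)
    (h1 : ∀ b c, G.Adj u b → G.Adj u c → 2 ≤ (G.neighborSet b).ncard →
      2 ≤ (G.neighborSet c).ncard → b = c) : Nonempty (G ≃g broomGraph n Δ) := by
  classical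
  obtain ⟨m, y, hm, hy0, hyd, hya, hcov⟩ := hT.exists_geodesic
    (by rw [← Set.ncard_pos, hu]; exact hΔ) h2 h1
  have hu1 : G.Adj u (y 1) := by simpa [hy0] using hya 0 hm
  have hnm : n = Δ + m := by
    -- The index 1 is left out because `y 1` is already counted among the neighbours of `u`.
    have hunion : (Set.univ : Set V)
        = G.neighborSet u ∪ y '' ((Finset.range (m + 1)).erase 1 : Finset ℕ) := by
      refine (Set.eq_univ_of_forall fun z => ?_).symm
      rcases hcov z with h | ⟨i, hi, rfl⟩
      · exact Or.inl h
      · by_cases h : i = 1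
        · subst h; exact Or.inl hu1
        · exact Or.inr ⟨i, by simp [h]; omega, rfl⟩
    have hdisj : Disjoint (G.neighborSet u)
        (y '' ((Finset.range (m + 1)).erase 1 : Finset ℕ)) := by
      rw [Set.disjoint_left]
      rintro _ hz ⟨i, hi, rfl⟩
      simp only [Finset.coe_erase, Finset.coe_range, Set.mem_sdiff, Set.mem_Iio,
        Set.mem_singleton_iff] at hi
      have := hyd i (by omega)
      rw [dist_eq_one_iff_adj.2 hz] at this
      omega
    have hinj : Set.InjOn y ((Finset.range (m + 1)).erase 1 : Finset ℕ) := by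
      intro i hi j hj hij
      simp only [Finset.coe_erase, Finset.coe_range, Set.mem_sdiff, Set.mem_Iio,
        Set.mem_singleton_iff] at hi hj
      rw [← hyd i (by omega), ← hyd j (by omega), hij]
    have hc := congrArg Set.ncard hunion
    rw [Set.ncard_union_eq hdisj, hinj.ncard_image, Set.ncard_coe_finset,
      Finset.card_erase_of_mem (by simp; omega), Finset.card_range, hu, Set.ncard_univ,
      Nat.card_eq_fintype_card, hn] at hc
    omega
  have hcard : Fintype.card ↥(G.neighborSet u \ {y 1}) = Δ - 1 := by
    rw [← Nat.card_eq_fintype_card, Nat.card_coe_set_eq, Set.ncard_sdiff_singleton_of_mem (show y 1 ∈ G.neighborSet u from hu1), hu]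
  let e : Fin (Δ - 1) ≃ ↥(G.neighborSet u \ {y 1}) := (Fintype.equivFinOfCardEq hcard).symm
  -- The hub of the broom is the last path vertex `n - Δ = m`, so the geodesic from `u` is read
  -- backwards; the other indices enumerate the neighbours of `u` except `y 1`.
  let f : Fin n → V := fun i =>
    if h : i.val ≤ m then y (m - i.val) else (e ⟨i.val - (m + 1), by omega⟩ : V)
  have hf1 : ∀ i : Fin n, i.val ≤ m → f i = y (m - i.val) := fun i hi => dif_pos hi
  have hf2 : ∀ i : Fin n, ∀ h : ¬ i.val ≤ m, f i = (e ⟨i.val - (m + 1), by omega⟩ : V) :=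
    fun i hi => dif_neg hi
  have hsurj : Function.Surjective f := by
    have hy : ∀ i ≤ m, ∃ j, f j = y i := fun i hi =>
      ⟨⟨m - i, by omega⟩, by
        rw [hf1 _ (Nat.sub_le _ _)]
        change y (m - (m - i)) = y i
        congr 1
        omega⟩
    intro z
    rcases hcov z with h | ⟨i, hi, rfl⟩
    · by_cases hz : z = y 1
      · rw [hz]; exact hy 1 hm
      · obtain ⟨j, hj⟩ := e.surjective ⟨z, h, hz⟩
        refine ⟨⟨m + 1 + j.val, by omega⟩, ?_⟩
        have hlt : ¬ m + 1 + j.val ≤ m := by omega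
        rw [hf2 ⟨m + 1 + j.val, by omega⟩ hlt]
        have : (⟨m + 1 + j.val - (m + 1), by omega⟩ : Fin (Δ - 1)) = j := Fin.ext (by simp)
        change (e ⟨m + 1 + j.val - (m + 1), _⟩ : V) = z
        rw [this, hj]
    · exact hy i hi
  have hbij : Function.Bijective f :=
    (Fintype.bijective_iff_surjective_and_card f).2 ⟨hsurj, by rw [Fintype.card_fin, hn]⟩
  let φ : Fin n ≃ V := Equiv.ofBijective f hbij
  have hsub : n - Δ = m := by omega
  have hrel : ∀ i j : Fin n, ((i.val + 1 = j.val ∧ j.val ≤ n - Δ) ∨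
      (i.val = n - Δ ∧ n - Δ < j.val)) → G.Adj (f i) (f j) := by
    rw [hsub]
    rintro i j (⟨h, h'⟩ | ⟨h, h'⟩)
    · rw [hf1 i (by omega), hf1 j h']
      have := hya (m - j.val) (by omega)
      rw [show m - i.val = m - j.val + 1 by omega]
      exact this.symm
    · rw [hf1 i h.le, hf2 j (by omega), h, Nat.sub_self, hy0]
      exact (e _).2.1
  have hle : broomGraph n Δ ≤ G.comap φ := by
    intro i j hij
    rcases (broomGraph_adj.1 hij).2 with h | h
    · exact hrel i j h
    · exact (hrel j i h).symm
  have hT' : (G.comap φ).IsTree := (Iso.comap φ G).isTree_iff.2 hT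
  -- One inclusion is enough: a tree is minimal among connected graphs, and the broom is connected.
  have heq : broomGraph n Δ = G.comap φ :=
    le_antisymm hle ((isTree_iff_minimal_connected.1 hT').2
      (broomGraph_connected (by omega) hΔ) hle)
  rw [heq]
  exact ⟨(Iso.comap φ G).symm⟩

/-- A vertex farthest from `w` is a leaf; its parent is `w` or has a parent of its own. -/
theorem IsTree.exists_adj_leaf [Finite V] {G : SimpleGraph V} (hT : G.IsTree) {w : V}
    (hw : 2 ≤ (G.neighborSet w).ncard) :
    ∃ l u, G.Adj l u ∧ (G.neighborSet l).ncard ≤ 1 ∧ 2 ≤ (G.neighborSet u).ncard := by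
  have : Nonempty V := ⟨w⟩
  obtain ⟨x, hx⟩ := Finite.exists_max (G.dist w)
  have hxw : x ≠ w := by
    rintro rfl
    obtain ⟨z, hz⟩ : (G.neighborSet x).Nonempty := by rw [← Set.ncard_pos]; omega
    have := hx z
    rw [dist_eq_one_iff_adj.2 hz] at this
    simp at this
  obtain ⟨y, hy, hyd⟩ := hT.connected.exists_adj_dist_add_one hxw
  refine ⟨x, y, hy, hT.ncard_neighborSet_le_one fun z _ => hx z, ?_⟩
  by_cases hyw : y = w
  · rwa [hyw]
  · obtain ⟨z, hz, hzd⟩ := hT.connected.exists_adj_dist_add_one hyw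
    refine two_le_ncard_neighborSet hy.symm hz ?_
    rintro rfl
    omega

theorem IsMaximizer.nonempty_iso_broomGraph [Fintype V] [DecidableEq V] {G : SimpleGraph V}
    {n Δ : ℕ} {α : ℝ} (hα₀ : 0 ≤ α) (hα₁ : α < 1) (hn : Fintype.card V = n) (hΔ : 2 ≤ Δ)
    (hG : G.IsMaximizer Δ α) : Nonempty (G ≃g broomGraph n Δ) := by
  obtain ⟨u, hu⟩ := hG.1.2.2
  obtain ⟨w, hw⟩ : (G.neighborSet u).Nonempty := by rw [← Set.ncard_pos]; omega
  have : Nontrivial V := ⟨u, w, Adj.ne hw⟩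
  have hT := hG.isTree hα₀ hα₁
  -- For `Δ = 2` the given `u` may lie inside the path, so the hub is taken next to a leaf.
  rcases hΔ.eq_or_lt with h | h
  · obtain ⟨l, v, hlv, hl, hv⟩ := hT.exists_adj_leaf (w := u) (by omega)
    have hle : ∀ x, (G.neighborSet x).ncard ≤ 2 := fun x => (hG.1.2.1 x).trans h.ge
    refine hT.nonempty_iso_broomGraph (u := v) hn (by omega) (by have := hle v; omega)
      (fun x _ => hle x) fun b c hb hc hb2 hc2 => ?_
    exact eq_of_ncard_neighborSet_le_two (hle v) hlv.symm hb hc (by rintro rfl; omega)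
      (by rintro rfl; omega)
  · exact hT.nonempty_iso_broomGraph hn (by omega) hu
      (fun v hv => hG.ncard_neighborSet_le_two hα₀ hα₁ hΔ hu hv)
      fun b c hb hc hb2 hc2 => hG.eq_of_two_le_ncard_neighborSet hα₀ hα₁ h hu hb hc hb2 hc2

theorem connectedMaxDegree_maxDegree [Fintype V] {G : SimpleGraph V} [DecidableRel G.Adj]
    (hG : G.Connected) : G.ConnectedMaxDegree G.maxDegree := by
  have h : ∀ x, (G.neighborSet x).ncard = G.degree x := fun x => by
    rw [← Nat.card_coe_set_eq, Nat.card_eq_fintype_card, card_neighborSet_eq_degree]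
  have := hG.nonempty
  obtain ⟨u, hu⟩ := G.exists_maximal_degree_vertex
  exact ⟨hG, fun x => (h x).trans_le (G.degree_le_maxDegree x), u, (h u).trans hu.symm⟩

theorem ConnectedMaxDegree.exists_isMaximizer [Fintype V] [DecidableEq V] {G : SimpleGraph V}
    {Δ : ℕ} (hG : G.ConnectedMaxDegree Δ) (α : ℝ) : ∃ H : SimpleGraph V, H.IsMaximizer Δ α := by
  obtain ⟨H, hH, hmax⟩ := Set.exists_max_image {H : SimpleGraph V | H.ConnectedMaxDegree Δ}
    (fun H => H.distanceAlphaSpectralRadius α) (Set.toFinite _) ⟨G, hG⟩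
  exact ⟨H, hH, hmax⟩

end Broom

end SimpleGraph

theorem mainTheorem3 {V : Type*} [Fintype V] [DecidableEq V] (G : SimpleGraph V)
    [DecidableRel G.Adj] (hG : G.Connected) (n Δ : ℕ) (hcard : Fintype.card V = n) (hn : 5 ≤ n)
    (hdeg : G.maxDegree = Δ) (hΔ : 2 ≤ Δ) (hΔn : Δ ≤ n - 1) (α : ℝ) (hα₀ : 0 ≤ α) (hα₁ : α < 1) :
    G.distanceAlphaSpectralRadius α ≤ (broomGraph n Δ).distanceAlphaSpectralRadius α ∧
      (G.distanceAlphaSpectralRadius α = (broomGraph n Δ).distanceAlphaSpectralRadius α ↔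
        Nonempty (G ≃g broomGraph n Δ)) := by
  have hcl : G.ConnectedMaxDegree Δ := hdeg ▸ SimpleGraph.connectedMaxDegree_maxDegree hG
  obtain ⟨H, hH⟩ := hcl.exists_isMaximizer α
  obtain ⟨φ⟩ := hH.nonempty_iso_broomGraph hα₀ hα₁ hcard hΔ
  rw [← φ.distanceAlphaSpectralRadius_eq α]
  refine ⟨hH.2 G hcl, fun h => ?_, fun ⟨ψ⟩ => ?_⟩
  -- Equality makes `G` itself a maximizer.
  · have hGmax : G.IsMaximizer Δ α := ⟨hcl, fun K hK => (hH.2 K hK).trans h.ge⟩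
    exact hGmax.nonempty_iso_broomGraph hα₀ hα₁ hcard hΔ
  · rw [φ.distanceAlphaSpectralRadius_eq α, ψ.distanceAlphaSpectralRadius_eq α]
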